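/- Let $A\subseteq B$ be an inclusion of $C^*$-algebras (not assumed unital), and let $M(B)$ be the multiplier algebra of $B$. For $S\subseteq B$ let $[S]$ denote the norm-closed linear span of $S$. A subalgebra $A$ is hereditary if $0\le b\le a$ with $a\in A$, $b\in B$ implies $b\in A$; a corner of $B$ is a hereditary subalgebra of the form $pBp$ with $p$ a projection in $M(B)$; $A$ is essential in $B$ if $x\in B$ and $xBAB=\{0\}$ imply $x=0$. A conditional expectation $E:B\to A$ is an idempotent positive linear map with range $A$ such that $E(ax)=aE(x)$ for $a\in A$, $x\in B$; its kernel ideal is $\ker E=\{x\in B: E(bxc)=0 \text{ for all } b,c\in B\}$. The following are equivalent: (i) $A$ is an essential corner $pBp$ of $B$, for some projection $p\in M(B)$. (ii) There is a conditional expectation $E:B\to A$ whose restriction to $[ABA]$ is multiplicative, i.e. $E(xy)=E(x)E(y)$ for all $x,y\in[ABA]$, and whose kernel ideal is $\ker E=\{0\}$. Moreover, a conditional expectation $E$ as in (ii) is unique, and if $A$ is an essential corner $pBp$ with $p\in M(B)$ a projection, then it is the compression map $E(x)=pxp$, $x\in B$. For every such $p$, one has $\lim_{n}\|xe_n-xp\|=0$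 for all $x\in B$ and every approximate unit $(e_n)$ of $A$, and $[BA]=Bp$. -/

import Mathlib

open scoped Pointwise MultiplierAlgebra Topology

namespace CStarInclusion

variable {B : Type*} [NonUnitalCStarAlgebra B]

/-- `[S]`: the norm-closed linear span of a subset `S` of `B`. -/
def closedSpan (S : Set B) : Submodule ℂ B :=
  (Submodule.span ℂ S).topologicalClosure

/-- `A` is essential in `B`: the ideal generated by `A` is an essential ideal, that is,
`x B A B = {0}` implies `x = 0`. -/
def IsEssential (A : NonUnitalStarSubalgebra ℂ B) : Prop :=
  ∀ x : B, (∀ b : B, ∀ a ∈ A, ∀ c : B, x * (b * a * c) = 0) → x = 0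

/-- `A` is hereditary in `B`. -/
def IsHereditary [PartialOrder B] (A : NonUnitalStarSubalgebra ℂ B) : Prop :=
  ∀ a ∈ A, ∀ b : B, 0 ≤ b → b ≤ a → b ∈ A

/-- The element `p x` of `B`, for `p` in the multiplier algebra of `B` and `x` in `B`. -/
noncomputable def leftMul (p : 𝓜(ℂ, B)) (x : B) : B := p.fst x

/-- The element `x p` of `B`, for `p` in the multiplier algebra of `B` and `x` in `B`. -/
noncomputable def rightMul (x : B) (p : 𝓜(ℂ, B)) : B := p.snd x

/-- The element `p x p` of `B`, for `p` in the multiplier algebra of `B` and `x` in `B`. -/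
noncomputable def compress (p : 𝓜(ℂ, B)) (x : B) : B := rightMul (leftMul p x) p

/-- `leftMul p x` is the product `p x` of the multiplier algebra. -/
theorem coe_leftMul (p : 𝓜(ℂ, B)) (x : B) :
    (DoubleCentralizer.coe ℂ (leftMul p x) : 𝓜(ℂ, B)) = p * DoubleCentralizer.coe ℂ x := by
  have h : ∀ y : B, p.fst (x * y) = p.fst x * y := fun y => by
    refine sub_eq_zero.mp (CStarRing.star_mul_self_eq_zero_iff _ |>.mp ?_)
    rw [mul_sub, ← mul_assoc, ← p.central, ← p.central]
    simp [mul_assoc]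
  ext y
  · simpa [leftMul] using (h y).symm
  · simpa [leftMul] using (p.central y x).symm

/-- `rightMul x p` is the product `x p` of the multiplier algebra. -/
theorem coe_rightMul (x : B) (p : 𝓜(ℂ, B)) :
    (DoubleCentralizer.coe ℂ (rightMul x p) : 𝓜(ℂ, B)) = DoubleCentralizer.coe ℂ x * p := by
  have h : ∀ y : B, p.snd (y * x) = y * p.snd x := fun y => by
    refine sub_eq_zero.mp (CStarRing.mul_star_self_eq_zero_iff _ |>.mp ?_)
    rw [sub_mul, mul_assoc y, p.central, p.central]
    simp [mul_assoc]
  ext y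
  · simpa [rightMul] using p.central x y
  · simpa [rightMul] using (h y).symm

/-- `A` is the corner `p B p` of `B`: `A` is a hereditary subalgebra, `p` is a projection in the
multiplier algebra of `B`, and `A = p B p`. -/
structure IsCorner [PartialOrder B] (A : NonUnitalStarSubalgebra ℂ B) (p : 𝓜(ℂ, B)) : Prop where
  hereditary : IsHereditary A
  projection : IsStarProjection p
  eq_corner : (A : Set B) = Set.range (compress p)

/-- `A` is an essential corner `p B p` of `B`. -/
structure IsEssentialCorner [PartialOrder B] (A : NonUnitalStarSubalgebra ℂ B)
    (p : 𝓜(ℂ, B)) : Prop where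
  corner : IsCorner A p
  essential : IsEssential A

/-- `E` is a conditional expectation from `B` to `A`: an idempotent positive linear map with
range `A` such that `E (a x) = a E x` for `a` in `A` and `x` in `B`. -/
structure IsConditionalExpectation [PartialOrder B] (A : NonUnitalStarSubalgebra ℂ B)
    (E : B →ₗ[ℂ] B) : Prop where
  idempotent : ∀ x, E (E x) = E x
  positive : ∀ x, 0 ≤ x → 0 ≤ E x
  range_eq : Set.range E = (A : Set B)
  map_mul : ∀ a ∈ A, ∀ x, E (a * x) = a * E x

/-- The kernel ideal `{x | E (b x c) = 0 for all b, c in B}` of `E`. -/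
def kernelIdeal (E : B →ₗ[ℂ] B) : Set B :=
  {x | ∀ b c : B, E (b * x * c) = 0}

/-- `E` is a conditional expectation from `B` to `A` that is multiplicative on the hereditary
subalgebra `[ABA]` and has trivial kernel ideal. -/
structure IsFaithfulHereditaryExpectation [PartialOrder B] (A : NonUnitalStarSubalgebra ℂ B)
    (E : B →ₗ[ℂ] B) : Prop where
  condExp : IsConditionalExpectation A E
  multiplicative : ∀ x ∈ closedSpan ((A : Set B) * Set.univ * (A : Set B)),
    ∀ y ∈ closedSpan ((A : Set B) * Set.univ * (A : Set B)), E (x * y) = E x * E y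
  kernel_trivial : kernelIdeal E = {0}

end CStarInclusion

open CStarInclusion Filter

/-! For a corner `A = pBp`, compression is the identity on `[ABA] ⊆ A`, hence multiplicative there,
and essentiality makes its kernel ideal trivial. Conversely, multiplicativity lets an element of
`[ABA]` killed by `E` be pushed into the kernel ideal, so `E` is injective on `[ABA]`
(`eq_zero_of_mem`). Applied to `x - E x` this gives `[ABA] ⊆ A`, and so the identity `a E(x) b = a x
b` for `a, b ∈ A` (`mul_map_mul`). The identity determines `E`, which is uniqueness. It also bounds
`‖x(e - f)‖²` by means of `E(x*x) ∈ A`, so `x e` converges along a contractive self-adjoint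
approximate unit of `A`; the limits define the projection `p` (`exists_multiplier`), and `pxp =
E(x)`. -/

namespace CStarInclusion

/-! ### Multiplier identities, the hull `[ABA]` and approximate units. -/

section General

variable {B : Type*} [NonUnitalCStarAlgebra B]

theorem compress_def (p : 𝓜(ℂ, B)) (x : B) : compress p x = p.snd (p.fst x) := rfl

/-- The compression `x ↦ p x p` as a linear map. -/
noncomputable def compressLinear (p : 𝓜(ℂ, B)) : B →ₗ[ℂ] B :=
  (p.snd : B →ₗ[ℂ] B) ∘ₗ (p.fst : B →ₗ[ℂ] B)

theorem compressLinear_apply (p : 𝓜(ℂ, B)) (x : B) : compressLinear p x = compress p x := rfl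

theorem fst_fst_apply {p : 𝓜(ℂ, B)} (hp : IsStarProjection p) (x : B) :
    p.fst (p.fst x) = p.fst x := by
  have h := congrArg (fun q : 𝓜(ℂ, B) => q.fst x) hp.isIdempotentElem.eq
  simpa using h

theorem snd_snd_apply {p : 𝓜(ℂ, B)} (hp : IsStarProjection p) (x : B) :
    p.snd (p.snd x) = p.snd x := by
  have h := congrArg (fun q : 𝓜(ℂ, B) => q.snd x) hp.isIdempotentElem.eq
  simpa using h

theorem star_fst_apply {p : 𝓜(ℂ, B)} (hp : IsStarProjection p) (x : B) :
    star (p.fst x) = p.snd (star x) := by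
  have h := congrArg (fun q : 𝓜(ℂ, B) => q.snd (star x)) hp.isSelfAdjoint.star_eq
  simpa using h

theorem star_snd_apply {p : 𝓜(ℂ, B)} (hp : IsStarProjection p) (x : B) :
    star (p.snd x) = p.fst (star x) := by
  have h := star_fst_apply hp (star x)
  rw [star_star] at h
  rw [← h, star_star]

theorem fst_mul (p : 𝓜(ℂ, B)) (x y : B) : p.fst (x * y) = p.fst x * y := by
  have h := congrArg (fun q : 𝓜(ℂ, B) => q.fst y) (coe_leftMul p x)
  simpa [leftMul] using h.symm

theorem snd_mul (p : 𝓜(ℂ, B)) (x y : B) : p.snd (x * y) = x * p.snd y := by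
  have h := congrArg (fun q : 𝓜(ℂ, B) => q.snd x) (coe_rightMul y p)
  simpa [rightMul] using h.symm

theorem fst_snd_comm (p : 𝓜(ℂ, B)) (x : B) : p.fst (p.snd x) = p.snd (p.fst x) := by
  refine sub_eq_zero.mp (CStarRing.mul_star_self_eq_zero_iff _ |>.mp ?_)
  rw [sub_mul, sub_eq_zero, ← fst_mul, p.central, p.central, fst_mul]

theorem eq_zero_of_forall_mul {A : NonUnitalStarSubalgebra ℂ B} {x : B} (hx : x ∈ A)
    (h : ∀ a ∈ A, x * a = 0) : x = 0 :=
  CStarRing.mul_star_self_eq_zero_iff _ |>.mp (h _ (star_mem hx))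

/-- Taking `a = ((x - y) b)*`, which lies in `A`, turns the hypothesis into `‖(x - y) b‖² = 0`. -/
theorem eq_of_forall_mul_mul {A : NonUnitalStarSubalgebra ℂ B} {x y : B} (hx : x ∈ A)
    (hy : y ∈ A) (h : ∀ a ∈ A, ∀ b ∈ A, a * x * b = a * y * b) : x = y := by
  have hxy : x - y ∈ A := sub_mem hx hy
  refine sub_eq_zero.mp (eq_zero_of_forall_mul hxy fun b hb => ?_)
  refine CStarRing.star_mul_self_eq_zero_iff _ |>.mp ?_
  have := h (star ((x - y) * b)) (star_mem (mul_mem hxy hb)) b hb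
  rw [← mul_assoc, mul_sub, sub_mul, this, sub_self]

/-- The linear subspace `[ABA]` of `B`. -/
abbrev hereditaryHull (A : NonUnitalStarSubalgebra ℂ B) : Submodule ℂ B :=
  closedSpan ((A : Set B) * Set.univ * (A : Set B))

theorem isClosed_closedSpan (S : Set B) : IsClosed (closedSpan S : Set B) :=
  Submodule.isClosed_topologicalClosure _

theorem closedSpan_le {S : Set B} {V : Submodule ℂ B} (hV : IsClosed (V : Set B))
    (h : S ⊆ V) : closedSpan S ≤ V :=
  Submodule.topologicalClosure_minimal _ (Submodule.span_le.mpr h) hV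

theorem subset_closedSpan (S : Set B) : S ⊆ closedSpan S := fun _ hx =>
  Submodule.le_topologicalClosure _ (Submodule.subset_span hx)

theorem mul_mul_mem_hereditaryHull {A : NonUnitalStarSubalgebra ℂ B} {a c : B} (ha : a ∈ A)
    (x : B) (hc : c ∈ A) : a * x * c ∈ hereditaryHull A :=
  subset_closedSpan _ (Set.mul_mem_mul (Set.mul_mem_mul ha (Set.mem_univ x)) hc)

theorem mul_mem_hereditaryHull {A : NonUnitalStarSubalgebra ℂ B} {a : B} (ha : a ∈ A) (z : B)
    {x : B} (hx : x ∈ hereditaryHull A) : a * z * x ∈ hereditaryHull A := by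
  let V : Submodule ℂ B := (hereditaryHull A).comap (LinearMap.mulLeft ℂ (a * z))
  have hV : IsClosed (V : Set B) :=
    (isClosed_closedSpan _).preimage (continuous_const.mul continuous_id)
  refine closedSpan_le hV ?_ hx
  rintro _ ⟨_, ⟨a', ha', b, -, rfl⟩, c, hc, rfl⟩
  change a * z * (a' * b * c) ∈ hereditaryHull A
  have heq : a * z * (a' * b * c) = a * (z * (a' * b)) * c := by simp only [mul_assoc]
  exact heq ▸ mul_mul_mem_hereditaryHull ha _ hc

theorem star_mem_hereditaryHull {A : NonUnitalStarSubalgebra ℂ B} {x : B}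
    (hx : x ∈ hereditaryHull A) : star x ∈ hereditaryHull A := by
  let S : Submodule ℂ B :=
    { carrier := {x | star x ∈ hereditaryHull A}
      add_mem' := fun {a b} ha hb => by
        simpa only [Set.mem_ofPred_eq, star_add] using add_mem ha hb
      zero_mem' := by simp
      smul_mem' := fun c a ha => by
        simpa only [Set.mem_ofPred_eq, star_smul] using Submodule.smul_mem _ (star c) ha }
  have hS : IsClosed (S : Set B) := (isClosed_closedSpan _).preimage continuous_star
  refine closedSpan_le hS ?_ hx
  rintro _ ⟨_, ⟨a, ha, b, -, rfl⟩, c, hc, rfl⟩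
  change star (a * b * c) ∈ hereditaryHull A
  rw [star_mul, star_mul, ← mul_assoc]
  exact mul_mul_mem_hereditaryHull (star_mem hc) _ (star_mem ha)

theorem mul_eq_zero_of_mem_hereditaryHull {A : NonUnitalStarSubalgebra ℂ B} {x y : B}
    (h : ∀ a ∈ A, x * a = 0) (hy : y ∈ hereditaryHull A) : x * y = 0 := by
  have hV : IsClosed ((LinearMap.mulLeft ℂ x).ker : Set B) :=
    isClosed_eq (continuous_const.mul continuous_id) continuous_const
  refine closedSpan_le hV ?_ hy
  rintro _ ⟨_, ⟨a, ha, b, -, rfl⟩, c, hc, rfl⟩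
  change x * (a * b * c) = 0
  rw [← mul_assoc, ← mul_assoc, h a ha, zero_mul, zero_mul]

/-- What annihilates `A` annihilates `[ABA]`, which contains `x` and `x*`. Thus `a x x* = 0`, so `a
x = 0` for all `a ∈ A`; then `x*` annihilates `A`, and `x* x = 0`. -/
theorem eq_zero_of_mem_hereditaryHull {A : NonUnitalStarSubalgebra ℂ B} {x : B}
    (hx : x ∈ hereditaryHull A) (h : ∀ a ∈ A, ∀ b ∈ A, a * x * b = 0) : x = 0 := by
  have h1 : ∀ a ∈ A, a * x = 0 := fun a ha => by
    have h2 : a * x * star x = 0 :=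
      mul_eq_zero_of_mem_hereditaryHull (h a ha) (star_mem_hereditaryHull hx)
    refine CStarRing.mul_star_self_eq_zero_iff _ |>.mp ?_
    rw [star_mul, ← mul_assoc, h2, zero_mul]
  have h3 : star x * x = 0 :=
    mul_eq_zero_of_mem_hereditaryHull (x := star x)
      (fun a ha => by simpa using congrArg star (h1 (star a) (star_mem ha))) hx
  exact CStarRing.star_mul_self_eq_zero_iff _ |>.mp h3

theorem exists_selfAdjoint_contractive_approximateUnit (A : NonUnitalStarSubalgebra ℂ B)
    (hA : IsClosed (A : Set B)) :
    ∃ l : Filter A, l.IsApproximateUnit ∧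
      ∀ᶠ e : A in l, star (e : B) = e ∧ ‖(e : B)‖ ≤ 1 := by
  have : IsClosed (A : Set B) := hA
  let _ : PartialOrder A := CStarAlgebra.spectralOrder A
  have : StarOrderedRing A := CStarAlgebra.spectralOrderedRing A
  have h := CStarAlgebra.increasingApproximateUnit A
  refine ⟨_, h.toIsApproximateUnit, ?_⟩
  filter_upwards [h.eventually_nonneg, h.eventually_norm] with e he he'
  exact ⟨congrArg Subtype.val he.isSelfAdjoint.star_eq, he'⟩

theorem tendsto_mul_left_coe {A : NonUnitalStarSubalgebra ℂ B} {l : Filter A}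
    (hl : l.IsApproximateUnit) {a : B} (ha : a ∈ A) :
    Tendsto (fun e : A => a * (e : B)) l (𝓝 a) :=
  (continuous_subtype_val.tendsto (⟨a, ha⟩ : A)).comp (hl.tendsto_mul_left ⟨a, ha⟩)

theorem tendsto_mul_right_coe {A : NonUnitalStarSubalgebra ℂ B} {l : Filter A}
    (hl : l.IsApproximateUnit) {a : B} (ha : a ∈ A) :
    Tendsto (fun e : A => (e : B) * a) l (𝓝 a) :=
  (continuous_subtype_val.tendsto (⟨a, ha⟩ : A)).comp (hl.tendsto_mul_right ⟨a, ha⟩)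

/-- Two successive limits: `c a = lim c a e` puts `A a` in the hull, and then `a = lim e a`. -/
theorem le_hereditaryHull {A : NonUnitalStarSubalgebra ℂ B} (hA : IsClosed (A : Set B)) {a : B}
    (ha : a ∈ A) : a ∈ hereditaryHull A := by
  obtain ⟨l, hl, -⟩ := exists_selfAdjoint_contractive_approximateUnit A hA
  have := hl.neBot
  have h : ∀ c ∈ A, c * a ∈ hereditaryHull A := fun c hc =>
    (isClosed_closedSpan _).mem_of_tendsto (tendsto_mul_left_coe hl (mul_mem hc ha))
      (Eventually.of_forall fun e => mul_mul_mem_hereditaryHull hc a e.2)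
  exact (isClosed_closedSpan _).mem_of_tendsto (tendsto_mul_right_coe hl ha)
    (Eventually.of_forall fun e => h _ e.2)

end General

variable {B : Type*} [NonUnitalCStarAlgebra B] [PartialOrder B] [StarOrderedRing B]

/-! ### From an essential corner to the expectation, and the limit formulas for `p`. -/

section Corner

variable {A : NonUnitalStarSubalgebra ℂ B} {p : 𝓜(ℂ, B)}

theorem IsCorner.compress_mem (h : IsCorner A p) (x : B) : compress p x ∈ A := by
  have : compress p x ∈ (A : Set B) := h.eq_corner ▸ Set.mem_range_self x
  exact this

theorem IsCorner.fst_eq (h : IsCorner A p) {a : B} (ha : a ∈ A) : p.fst a = a := by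
  have ha' : a ∈ Set.range (compress p) := h.eq_corner ▸ ha
  obtain ⟨x, rfl⟩ := ha'
  rw [compress_def, fst_snd_comm, fst_fst_apply h.projection]

theorem IsCorner.snd_eq (h : IsCorner A p) {a : B} (ha : a ∈ A) : p.snd a = a := by
  have ha' : a ∈ Set.range (compress p) := h.eq_corner ▸ ha
  obtain ⟨x, rfl⟩ := ha'
  rw [compress_def, snd_snd_apply h.projection]

theorem IsCorner.compress_eq (h : IsCorner A p) {a : B} (ha : a ∈ A) : compress p a = a := by
  rw [compress_def, h.fst_eq ha, h.snd_eq ha]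

theorem IsCorner.mem_iff (h : IsCorner A p) {a : B} : a ∈ A ↔ p.fst a = a ∧ p.snd a = a :=
  ⟨fun ha => ⟨h.fst_eq ha, h.snd_eq ha⟩, fun ⟨h1, h2⟩ => by
    have := h.compress_mem a
    rwa [compress_def, h1, h2] at this⟩

theorem IsCorner.hereditaryHull_le (h : IsCorner A p) (hA : IsClosed (A : Set B)) {x : B}
    (hx : x ∈ hereditaryHull A) : x ∈ A := by
  refine closedSpan_le (V := A.toSubmodule) hA ?_ hx
  rintro _ ⟨_, ⟨a, ha, b, -, rfl⟩, c, hc, rfl⟩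
  change a * b * c ∈ A
  rw [h.mem_iff, fst_mul, fst_mul, snd_mul, h.fst_eq ha, h.snd_eq hc]
  exact ⟨rfl, rfl⟩

theorem compress_nonneg (hp : IsStarProjection p) {x : B} (hx : 0 ≤ x) : 0 ≤ compress p x := by
  obtain ⟨y, rfl⟩ := CStarAlgebra.nonneg_iff_eq_star_mul_self.mp hx
  rw [compress_def, fst_mul, snd_mul, ← star_star (p.fst (star y)), star_fst_apply hp, star_star]
  exact star_mul_self_nonneg _

theorem IsEssentialCorner.isFaithfulHereditaryExpectation (h : IsEssentialCorner A p)
    (hA : IsClosed (A : Set B)) : IsFaithfulHereditaryExpectation A (compressLinear p) where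
  condExp :=
    { idempotent := fun x => h.corner.compress_eq (h.corner.compress_mem x)
      positive := fun x hx => compress_nonneg h.corner.projection hx
      range_eq := h.corner.eq_corner.symm
      map_mul := fun a ha x => by
        simp only [compressLinear_apply, compress_def]
        rw [fst_mul, snd_mul, h.corner.fst_eq ha, ← fst_snd_comm, ← p.central,
          h.corner.snd_eq ha] }
  multiplicative := fun x hx y hy => by
    have hx' := h.corner.hereditaryHull_le hA hx
    have hy' := h.corner.hereditaryHull_le hA hy
    simp only [compressLinear_apply]
    rw [h.corner.compress_eq hx', h.corner.compress_eq hy', h.corner.compress_eq (mul_mem hx' hy')]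
  kernel_trivial := by
    refine Set.eq_singleton_iff_unique_mem.mpr ⟨fun b c => by simp, fun x hx => ?_⟩
    refine h.essential x fun b a ha c => ?_
    -- Since `a = pa`, `(xba)*(xba) = a* (p b* x* x b p) a`, and the middle factor is a value of the
    -- expectation that vanishes.
    have hy : x * (b * a) = 0 := by
      refine CStarRing.star_mul_self_eq_zero_iff _ |>.mp ?_
      have h0 : p.snd (p.fst (star b * star x * x * b)) = 0 := by
        have := hx (star b * star x) b
        rwa [compressLinear_apply, compress_def] at this
      have h1 : star a * p.snd (p.fst (star b * star x * x * b)) * a =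
          star (x * (b * a)) * (x * (b * a)) := by
        rw [mul_assoc, p.central, h.corner.fst_eq ha, ← mul_assoc, ← p.central,
          h.corner.snd_eq (star_mem ha)]
        simp only [star_mul, mul_assoc]
      rw [← h1, h0, mul_zero, zero_mul]
    rw [← mul_assoc, hy, zero_mul]

/-- The norm `‖y e - y‖` depends on `y` only through `y* y`, so `y` may be replaced by `k = (y*
y)^(1/2)`, which lies in `A`. Passing to the square root avoids any bound on the approximate unit.
-/
theorem IsCorner.tendsto_mul (h : IsCorner A p) {l : Filter A}
    (hl : l.IsApproximateUnit) {y : B} (hy : p.snd y = y) :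
    Tendsto (fun e : A => y * (e : B)) l (𝓝 y) := by
  have hp := h.projection
  obtain ⟨k, hk, hky⟩ : ∃ k : B, 0 ≤ k ∧ star k * k = star y * y := by
    refine ⟨CFC.sqrt (star y * y), CFC.sqrt_nonneg _, ?_⟩
    rw [(CFC.sqrt_nonneg _).isSelfAdjoint.star_eq]
    exact CFC.sqrt_mul_sqrt_self _ (star_mul_self_nonneg y)
  -- `‖k - kp‖` is likewise determined by `k* k = y* y`, and `y - yp = 0`.
  have hkp : p.snd k = k := by
    refine (sub_eq_zero.mp (CStarRing.star_mul_self_eq_zero_iff _ |>.mp ?_)).symm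
    rw [mul_sub, ← snd_mul, star_sub, sub_mul, star_snd_apply hp, ← fst_mul, hky, fst_mul,
      ← star_snd_apply hp, hy, sub_self, map_zero, sub_self]
  have hpk : p.fst k = k := by
    have := star_snd_apply hp k
    rw [hkp, hk.isSelfAdjoint.star_eq] at this
    exact this.symm
  have hkA : k ∈ A := h.mem_iff.mpr ⟨hpk, hkp⟩
  have hlim := tendsto_mul_left_coe hl hkA
  rw [tendsto_iff_norm_sub_tendsto_zero] at hlim ⊢
  refine hlim.congr fun e => ?_
  have key : ∀ z : B, star (z * (e : B) - z) * (z * (e : B) - z) =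
      star (e : B) * (star z * z) * e - star (e : B) * (star z * z) - (star z * z) * e
        + star z * z := fun z => by
    simp only [star_sub, star_mul]; noncomm_ring
  have h2 : ‖k * (e : B) - k‖ * ‖k * (e : B) - k‖ = ‖y * (e : B) - y‖ * ‖y * (e : B) - y‖ := by
    rw [← CStarRing.norm_star_mul_self, ← CStarRing.norm_star_mul_self, key, key, hky]
  exact (mul_self_inj_of_nonneg (norm_nonneg _) (norm_nonneg _)).mp h2

theorem IsCorner.closedSpan_eq (h : IsCorner A p) (hA : IsClosed (A : Set B)) :
    (closedSpan (Set.univ * (A : Set B)) : Set B) = Set.range (fun x : B => rightMul x p) := by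
  refine Set.Subset.antisymm (fun x hx => ?_) ?_
  -- The fixed points of right multiplication by `p` form a closed subspace containing `BA`.
  · let V : Submodule ℂ B := LinearMap.eqLocus (p.snd : B →ₗ[ℂ] B) LinearMap.id
    have hV : IsClosed (V : Set B) := isClosed_eq p.snd.continuous continuous_id
    have hx' : x ∈ V := by
      refine closedSpan_le hV ?_ hx
      rintro _ ⟨b, -, a, ha, rfl⟩
      change p.snd (b * a) = b * a
      rw [snd_mul, h.snd_eq ha]
    exact ⟨x, hx'⟩
  · rintro _ ⟨x, rfl⟩
    obtain ⟨l, hl, -⟩ := exists_selfAdjoint_contractive_approximateUnit A hA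
    have := hl.neBot
    refine (isClosed_closedSpan _).mem_of_tendsto (h.tendsto_mul hl
      (snd_snd_apply h.projection x)) (Eventually.of_forall fun e => ?_)
    exact subset_closedSpan _ (Set.mul_mem_mul (Set.mem_univ _) e.2)

theorem IsCorner.tendsto_norm_mul_sub (h : IsCorner A p)
    {l : Filter A} (hl : l.IsApproximateUnit) (x : B) :
    Tendsto (fun e : A => ‖x * (e : B) - rightMul x p‖) l (𝓝 0) := by
  have := h.tendsto_mul hl (snd_snd_apply h.projection x)
  rw [tendsto_iff_norm_sub_tendsto_zero] at this
  refine this.congr fun e => ?_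
  rw [p.central, h.fst_eq e.2]
  rfl

end Corner

/-! ### From the expectation to uniqueness, essentiality and the projection. -/

section Expectation

variable {A : NonUnitalStarSubalgebra ℂ B} {E : B →ₗ[ℂ] B}

theorem IsConditionalExpectation.map_mem (h : IsConditionalExpectation A E) (x : B) :
    E x ∈ A := by
  have : E x ∈ (A : Set B) := h.range_eq ▸ Set.mem_range_self x
  exact this

theorem IsConditionalExpectation.map_eq (h : IsConditionalExpectation A E) {a : B}
    (ha : a ∈ A) : E a = a := by
  have ha' : a ∈ Set.range E := h.range_eq ▸ ha
  obtain ⟨x, rfl⟩ := ha'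
  exact h.idempotent x

theorem IsConditionalExpectation.map_star (h : IsConditionalExpectation A E) (x : B) :
    E (star x) = star (E x) :=
  StarHomClass.map_star (PositiveLinearMap.mk₀ E h.positive) x

/-- Positivity makes `E` commute with the adjoint, which carries the left module property to the
right. -/
theorem IsConditionalExpectation.map_mul_right (h : IsConditionalExpectation A E) {a : B}
    (ha : a ∈ A) (x : B) : E (x * a) = E x * a := by
  have := h.map_mul (star a) (star_mem ha) (star x)
  rw [← star_mul, h.map_star, h.map_star, ← star_mul] at this
  exact star_injective this

/-- It suffices that every `a₁ x a₂` lies in the kernel ideal. Compressing `E(b a₁ x a₂ c)` by `a,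
a' ∈ A` gives `E` of the product of `a b a₁`, `x` and `a₂ c a'`, all in `[ABA]`; multiplicativity
isolates the factor `E x = 0`. -/
theorem IsFaithfulHereditaryExpectation.eq_zero_of_mem (h : IsFaithfulHereditaryExpectation A E)
    {x : B} (hx : x ∈ hereditaryHull A) (hEx : E x = 0) : x = 0 := by
  refine eq_zero_of_mem_hereditaryHull hx fun a₁ h₁ a₂ h₂ => ?_
  have hker : a₁ * x * a₂ ∈ kernelIdeal E := fun b c => by
    refine eq_of_forall_mul_mul (h.condExp.map_mem _) (zero_mem A) fun a ha a' ha' => ?_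
    rw [mul_zero, zero_mul, ← h.condExp.map_mul a ha, ← h.condExp.map_mul_right ha']
    have heq : a * (b * (a₁ * x * a₂) * c) * a' = (a * (b * a₁) * x) * (a₂ * c * a') := by
      simp only [mul_assoc]
    rw [heq, h.multiplicative _ (mul_mem_hereditaryHull ha _ hx) _
      (mul_mul_mem_hereditaryHull h₂ c ha'), h.multiplicative _ _ _ hx, hEx, mul_zero, zero_mul]
    rw [← mul_assoc]
    exact mul_mul_mem_hereditaryHull ha b h₁
  rw [h.kernel_trivial] at hker
  exact hker

theorem IsFaithfulHereditaryExpectation.hereditaryHull_le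
    (h : IsFaithfulHereditaryExpectation A E) (hA : IsClosed (A : Set B)) {x : B}
    (hx : x ∈ hereditaryHull A) : x ∈ A := by
  have hEx := h.condExp.map_mem x
  have : x - E x = 0 := h.eq_zero_of_mem (sub_mem hx (le_hereditaryHull hA hEx)) <| by
    rw [map_sub, h.condExp.idempotent, sub_self]
  rwa [← sub_eq_zero.mp this] at hEx

theorem IsFaithfulHereditaryExpectation.mul_map_mul (h : IsFaithfulHereditaryExpectation A E)
    (hA : IsClosed (A : Set B)) {a b : B} (ha : a ∈ A) (hb : b ∈ A) (x : B) :
    a * E x * b = a * x * b := by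
  rw [← h.condExp.map_mul a ha, ← h.condExp.map_mul_right hb, h.condExp.map_eq]
  exact h.hereditaryHull_le hA (mul_mul_mem_hereditaryHull ha x hb)

theorem IsFaithfulHereditaryExpectation.unique {E' : B →ₗ[ℂ] B}
    (h : IsFaithfulHereditaryExpectation A E) (h' : IsFaithfulHereditaryExpectation A E')
    (hA : IsClosed (A : Set B)) : E = E' :=
  LinearMap.ext fun x => eq_of_forall_mul_mul (h.condExp.map_mem x) (h'.condExp.map_mem x)
    fun a ha b hb => by rw [h.mul_map_mul hA ha hb, h'.mul_map_mul hA ha hb]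

/-- If `xBAB = 0` then `xBA = 0`, so `E(bxc) a = E(bxca) = 0` for all `a ∈ A`, and `x` lies in the
kernel ideal. -/
theorem IsFaithfulHereditaryExpectation.isEssential (h : IsFaithfulHereditaryExpectation A E) :
    IsEssential A := fun x hx => by
  have h1 : ∀ c : B, ∀ a ∈ A, x * c * a = 0 := fun c a ha => by
    refine CStarRing.mul_star_self_eq_zero_iff _ |>.mp ?_
    have := hx c a ha (star (x * c * a))
    rw [← this]; noncomm_ring
  have hker : x ∈ kernelIdeal E := fun b c =>
    eq_zero_of_forall_mul (h.condExp.map_mem _) fun a ha => by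
      rw [← h.condExp.map_mul_right ha, mul_assoc, mul_assoc, ← mul_assoc x, h1 c a ha, mul_zero,
        map_zero]
  rw [h.kernel_trivial] at hker
  exact hker

/-- `(x(e - f))* x(e - f) = (e - f)* E(x* x) (e - f)`, and `E(x* x) e` is Cauchy because `E(x* x) ∈
A`. -/
theorem IsFaithfulHereditaryExpectation.exists_tendsto (h : IsFaithfulHereditaryExpectation A E)
    (hA : IsClosed (A : Set B)) {l : Filter A} (hl : l.IsApproximateUnit)
    (hl' : ∀ᶠ e : A in l, star (e : B) = e ∧ ‖(e : B)‖ ≤ 1) (x : B) :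
    ∃ y, Tendsto (fun e : A => x * (e : B)) l (𝓝 y) := by
  have := hl.neBot
  refine cauchy_map_iff_exists_tendsto.mp ?_
  have hk := (tendsto_mul_left_coe hl (h.condExp.map_mem (star x * x))).cauchy_map
  rw [Metric.cauchy_iff] at hk ⊢
  refine ⟨inferInstance, fun ε hε => ?_⟩
  -- The divisor 2 absorbs the outer factor, since `‖(e - f)*‖ ≤ 2`.
  obtain ⟨t, ht, htε⟩ := hk.2 (ε * ε / 2) (by positivity)
  refine ⟨(fun e : A => x * (e : B)) ''
    ({e | star (e : B) = e ∧ ‖(e : B)‖ ≤ 1} ∩ (fun e : A => E (star x * x) * (e : B)) ⁻¹' t),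
    image_mem_map (inter_mem hl' ht), ?_⟩
  rintro _ ⟨e, ⟨he, he'⟩, rfl⟩ _ ⟨f, ⟨hf, hf'⟩, rfl⟩
  have hd := htε _ he' _ hf'
  rw [dist_eq_norm, ← mul_sub] at hd ⊢
  have hef : (e : B) - f ∈ A := sub_mem e.2 f.2
  have heq : star (x * ((e : B) - f)) * (x * ((e : B) - f)) =
      star ((e : B) - f) * (E (star x * x) * ((e : B) - f)) := by
    rw [← mul_assoc (star _) (E _), h.mul_map_mul hA (star_mem hef) hef, star_mul]
    simp only [mul_assoc]
  have h2 : ‖star ((e : B) - f)‖ ≤ 2 := by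
    rw [norm_star]
    exact (norm_sub_le _ _).trans (by linarith [he.2, hf.2])
  have h3 : ‖x * ((e : B) - f)‖ * ‖x * ((e : B) - f)‖ < ε * ε := by
    rw [← CStarRing.norm_star_mul_self, heq]
    calc _ ≤ ‖star ((e : B) - f)‖ * ‖E (star x * x) * ((e : B) - f)‖ := norm_mul_le _ _
      _ ≤ 2 * ‖E (star x * x) * ((e : B) - f)‖ := by gcongr
      _ < ε * ε := by linarith
  exact lt_of_mul_self_lt_mul_self₀ hε.le h3

theorem IsFaithfulHereditaryExpectation.exists_multiplier
    (h : IsFaithfulHereditaryExpectation A E) (hA : IsClosed (A : Set B)) {l : Filter A}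
    (hl : l.IsApproximateUnit) (hl' : ∀ᶠ e : A in l, star (e : B) = e ∧ ‖(e : B)‖ ≤ 1) :
    ∃ p : 𝓜(ℂ, B), (∀ x, Tendsto (fun e : A => x * (e : B)) l (𝓝 (p.snd x))) ∧
      ∀ x, p.fst x = star (p.snd (star x)) := by
  have := hl.neBot
  choose R hR using h.exists_tendsto hA hl hl'
  have hRb : ∀ x, ‖R x‖ ≤ 1 * ‖x‖ := fun x => by
    refine le_of_tendsto (hR x).norm (hl'.mono fun e he => ?_)
    rw [mul_comm]
    exact (norm_mul_le _ _).trans (by gcongr; exact he.2)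
  let R' : B →ₗ[ℂ] B :=
    { toFun := R
      map_add' := fun x y => tendsto_nhds_unique (hR _) <| by
        simpa only [add_mul] using (hR x).add (hR y)
      map_smul' := fun c x => tendsto_nhds_unique (hR _) <| by
        simpa only [smul_mul_assoc, RingHom.id_apply] using (hR x).const_smul c }
  let L' : B →ₗ[ℂ] B :=
    { toFun := fun x => star (R' (star x))
      map_add' := fun x y => by simp
      map_smul' := fun c x => by simp [star_smul] }
  have hL : ∀ x, Tendsto (fun e : A => (e : B) * x) l (𝓝 (L' x)) := fun x => by
    refine ((hR (star x)).star).congr' (hl'.mono fun e he => ?_)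
    rw [star_mul, star_star, he.1]
  refine ⟨⟨⟨L'.mkContinuous 1 fun x => ?_, R'.mkContinuous 1 hRb⟩, fun x y => ?_⟩, hR,
    fun x => rfl⟩
  · change ‖star (R (star x))‖ ≤ _
    rw [norm_star]
    exact (hRb _).trans_eq (by rw [norm_star])
  -- The centrality relation holds because both sides are the limit of `x e y`.
  · refine tendsto_nhds_unique (((hR x).mul_const y)) ?_
    simp only [mul_assoc]
    exact (hL y).const_mul x

theorem isHereditary_of_eq_corner {p : 𝓜(ℂ, B)} (hp : IsStarProjection p)
    (hA : (A : Set B) = Set.range (compress p)) : IsHereditary A := by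
  have hmem : ∀ a : B, a ∈ A ↔ a ∈ Set.range (compress p) := fun a => by
    rw [← hA]; rfl
  intro a ha b hb hba
  -- This is `q(x) = (1 - p) x (1 - p)`, written without a unit. It is positive and vanishes on
  -- `pBp`, so `0 ≤ q(b) ≤ q(a) = 0`; with `b = k* k` this says `k = kp`, whence `b = pbp`.
  let q : B →ₗ[ℂ] B := LinearMap.id - (p.fst : B →ₗ[ℂ] B) - (p.snd : B →ₗ[ℂ] B) + compressLinear p
  have hq : ∀ y : B, q (star y * y) = star (y - p.snd y) * (y - p.snd y) := fun y => by
    change star y * y - p.fst (star y * y) - p.snd (star y * y) + p.snd (p.fst (star y * y)) = _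
    rw [star_sub, sub_mul, mul_sub, mul_sub, star_snd_apply hp, fst_mul, snd_mul, snd_mul]
    abel
  have hpos : ∀ x : B, 0 ≤ x → 0 ≤ q x := fun x hx => by
    obtain ⟨y, rfl⟩ := CStarAlgebra.nonneg_iff_eq_star_mul_self.mp hx
    rw [hq]
    exact star_mul_self_nonneg _
  have hqa : q a = 0 := by
    obtain ⟨x, rfl⟩ := (hmem a).mp ha
    change compress p x - p.fst (compress p x) - p.snd (compress p x)
      + p.snd (p.fst (compress p x)) = 0
    rw [compress_def, fst_snd_comm, fst_fst_apply hp, snd_snd_apply hp]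
    abel
  have hqb : q b = 0 := by
    refine le_antisymm ?_ (hpos b hb)
    have := hpos (a - b) (sub_nonneg.mpr hba)
    rwa [map_sub, hqa, sub_nonneg] at this
  obtain ⟨k, rfl⟩ := CStarAlgebra.nonneg_iff_eq_star_mul_self.mp hb
  rw [hq] at hqb
  have hk : p.snd k = k :=
    (sub_eq_zero.mp (CStarRing.star_mul_self_eq_zero_iff _ |>.mp hqb)).symm
  refine (hmem _).mpr ⟨star k * k, ?_⟩
  rw [compress_def, fst_mul, snd_mul, ← star_snd_apply hp, hk]

theorem IsFaithfulHereditaryExpectation.exists_isEssentialCorner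
    (h : IsFaithfulHereditaryExpectation A E) (hA : IsClosed (A : Set B)) :
    ∃ p : 𝓜(ℂ, B), IsEssentialCorner A p := by
  obtain ⟨l, hl, hl'⟩ := exists_selfAdjoint_contractive_approximateUnit A hA
  have := hl.neBot
  obtain ⟨p, hpR, hpL⟩ := h.exists_multiplier hA hl hl'
  have hL : ∀ x, Tendsto (fun e : A => (e : B) * x) l (𝓝 (p.fst x)) := fun x => by
    rw [hpL]
    refine ((hpR (star x)).star).congr' (hl'.mono fun e he => ?_)
    rw [star_mul, star_star, he.1]
  have hAR : ∀ a ∈ A, p.snd a = a := fun a ha =>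
    tendsto_nhds_unique (hpR a) (tendsto_mul_left_coe hl ha)
  have hAL : ∀ a ∈ A, p.fst a = a := fun a ha =>
    tendsto_nhds_unique (hL a) (tendsto_mul_right_coe hl ha)
  have hRR : ∀ x, p.snd (p.snd x) = p.snd x := fun x => by
    refine tendsto_nhds_unique (hpR _) ((hpR x).congr fun e => ?_)
    rw [p.central, hAL _ e.2]
  have hp : IsStarProjection p := by
    refine ⟨?_, ?_⟩
    · ext x
      · simp [hpL, hRR]
      · simp [hRR]
    · ext x
      · simp [hpL]
      · simp [hpL]
  -- For fixed `e`, letting `f` run in `f E(x) e = f x e` gives `E(x) e = (px) e`; the limit over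
  -- `e` then gives `E(x) = pxp`.
  have hE : ∀ x, compress p x = E x := fun x => by
    refine tendsto_nhds_unique (hpR (p.fst x))
      ((tendsto_mul_left_coe hl (h.condExp.map_mem x)).congr fun e => ?_)
    refine tendsto_nhds_unique (tendsto_mul_right_coe hl (mul_mem (h.condExp.map_mem x) e.2))
      (((hL x).mul_const (e : B)).congr fun f => ?_)
    rw [← mul_assoc, h.mul_map_mul hA f.2 e.2]
  have hc : (A : Set B) = Set.range (compress p) := by
    rw [← h.condExp.range_eq]
    exact congrArg Set.range (funext hE).symm
  exact ⟨p, ⟨isHereditary_of_eq_corner hp hc, hp, hc⟩, h.isEssential⟩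

end Expectation

end CStarInclusion

theorem proposition5p3 {B : Type*} [NonUnitalCStarAlgebra B] [PartialOrder B] [StarOrderedRing B]
    (A : NonUnitalStarSubalgebra ℂ B) (hA : IsClosed (A : Set B)) :
    ((∃ p : 𝓜(ℂ, B), CStarInclusion.IsEssentialCorner A p) ↔
      ∃ E : B →ₗ[ℂ] B, CStarInclusion.IsFaithfulHereditaryExpectation A E) ∧
    (∀ E E' : B →ₗ[ℂ] B, CStarInclusion.IsFaithfulHereditaryExpectation A E →
      CStarInclusion.IsFaithfulHereditaryExpectation A E' → E = E') ∧
    ∀ p : 𝓜(ℂ, B), CStarInclusion.IsEssentialCorner A p →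
      (∀ E : B →ₗ[ℂ] B, CStarInclusion.IsFaithfulHereditaryExpectation A E →
        ∀ x : B, E x = CStarInclusion.compress p x) ∧
      (∀ l : Filter A, l.IsApproximateUnit → ∀ x : B,
        Filter.Tendsto (fun e : A => ‖x * (e : B) - CStarInclusion.rightMul x p‖) l (𝓝 0)) ∧
      (CStarInclusion.closedSpan (Set.univ * (A : Set B)) : Set B) =
        Set.range (fun x : B => CStarInclusion.rightMul x p) := by
  refine ⟨⟨fun ⟨p, hp⟩ => ⟨_, hp.isFaithfulHereditaryExpectation hA⟩,
    fun ⟨E, hE⟩ => hE.exists_isEssentialCorner hA⟩, fun E E' hE hE' => hE.unique hE' hA,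
    fun p hp => ⟨fun E hE x => ?_, fun l hl x => hp.corner.tendsto_norm_mul_sub hl x,
      hp.corner.closedSpan_eq hA⟩⟩
  rw [hE.unique (hp.isFaithfulHereditaryExpectation hA) hA, compressLinear_apply]
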